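/- For a nonzero polynomial $P\in\mathbb C[z]$ let $$\|P\|_0=\exp\left(\frac1\pi\iint_{|z|<1}\log|P(z)|\,dA(z)\right),$$ where $dA$ is planar Lebesgue measure, and let $\mathbb T=\{z\in\mathbb C:|z|=1\}$. Let $E\subset\mathbb C$ be a closed set with $\mathbb T\not\subset E$. Then there is a constant $C=C(E)>1$, depending only on $E$, such that the following holds. Let $(P_n)_{n\in N}$ be a sequence of polynomials $P_n\in\mathbb Z[z]$ with $\deg P_n=n$, where the index set $N$ is $\mathbb N$ or any infinite subset of it, and suppose that for each $n\in N$ all zeros of $P_n$ in $\mathbb C$ are simple and lie in $E$. Then $$\liminf_{n\to\infty,\ n\in N}\|P_n\|_0^{1/n}\ge C>1,$$ where the lower limit is taken in $[0,\infty]$. -/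

import Mathlib

open Polynomial MeasureTheory Filter

/-- The `A⁰` Bergman space norm (areal Mahler measure) of a complex polynomial,
`‖P‖₀ = exp ((1/π) ∬_{|z|<1} log |P(z)| dA)`, where `volume` on `ℂ` is planar Lebesgue measure.
For `P ≠ 0` the integrand is integrable on the disk and is `-∞` only at the finitely many zeros
of `P`, a null set, so the convention `Real.log 0 = 0` does not affect the value. -/
noncomputable def bergmanNorm (P : ℂ[X]) : ℝ :=
  Real.exp ((1 / Real.pi) * ∫ z in Metric.ball (0 : ℂ) 1, Real.log ‖P.eval z‖)

/-!
Write `P = a ∏ (X - αᵢ)` and `s(z) = max 0 (1 - |z|²)`. Integrating in polar coordinates gives the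
areal Jensen formula `log ‖P‖₀ = log |a| + ∑ (log⁺ |αᵢ| - s(αᵢ) / 2)`
(`log_bergmanNorm_C_mul_prod`). Suppose that `log ‖P‖₀ < ε n` for a small `ε`.

*The zeros are near the unit circle.* The lowest nonzero coefficient of `P` is an integer, so
`log |a| + ∑_{αᵢ ≠ 0} log |αᵢ| ≥ 0`. Subtracting this from Jensen's formula leaves a sum of
nonnegative terms which dominates `∑ s(αᵢ)² / 4`, up to a bounded error from a simple zero at `0`.
Hence `∑ s(αᵢ)²`, then `∑ s(αᵢ)`, and finally `log |a| + ∑ (log⁺ |αᵢ| + s(αᵢ))` are small compared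
with `n` (`sum_circleDeviation_le`).

*The discriminant is then too small.* The zeros avoid a disk around a point `ζ` of the unit circle.
The rest of the circle has capacity less than `1`: some monic `q` of degree `d` satisfies `|q| < 1`
there, and `|q| ≤ exp (-κ + K t)` off the disk, where `t` measures the distance to the unit circle
(`exists_monic_norm_eval_le_exp`). Writing the Vandermonde determinant of the zeros in the basis
`q ^ (k / d) * X ^ (k % d)` of monic polynomials and expanding it by Leibniz's formula bounds it by
`n! exp (-κ n² / (2d) + O(n) + O(n) ∑ t(αᵢ))` (`norm_det_vandermonde_le`). On the other hand `P` has
simple zeros, so its resultant with `P'` is a nonzero integer, and `|a|^(2n-1) |det|² ≥ 1`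
(`one_le_norm_pow_mul_norm_det_vandermonde`). For small `ε` and large `n`, depending only on `ζ` and
the radius of the disk, these bounds contradict each other.
-/

/-! ### Jensen's formula for the area measure of the disk -/

lemma integrableOn_log_norm_sub_ball (a : ℂ) :
    IntegrableOn (fun z : ℂ => Real.log ‖z - a‖) (Metric.ball 0 1) := by
  have h0 : Integrable (fun z : ℂ => (Set.Iio (1 + ‖a‖)).indicator Real.log ‖z‖) := by
    rw [integrable_fun_norm_addHaar]
    simp only [Complex.finrank_real_complex, Nat.add_one_sub_one, pow_one, smul_eq_mul]
    have h1 : IntegrableOn (fun y : ℝ => y * Real.log y) (Set.Icc 0 (1 + ‖a‖)) :=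
      (Real.continuous_mul_log.continuousOn).integrableOn_compact isCompact_Icc
    have h2 : IntegrableOn ((Set.Iio (1 + ‖a‖)).indicator fun y : ℝ => y * Real.log y)
        (Set.Ioi 0) := by
      rw [IntegrableOn, integrable_indicator_iff measurableSet_Iio, IntegrableOn,
        Measure.restrict_restrict measurableSet_Iio]
      exact h1.mono_set fun y hy => ⟨hy.2.le, hy.1.le⟩
    refine h2.congr_fun (fun y _ => ?_) measurableSet_Ioi
    simp only [Set.indicator]
    split_ifs <;> simp
  have h3 := (h0.comp_sub_right a).integrableOn (s := Metric.ball 0 1)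
  refine h3.congr_fun (fun z hz => ?_) measurableSet_ball
  have : ‖z - a‖ < 1 + ‖a‖ := (norm_sub_le z a).trans_lt (by simpa using hz)
  simp [Set.indicator, this]

/-- Integration over the unit disk in polar coordinates, with the angular integral written as a
circle average. -/
lemma setIntegral_ball_eq_integral_circleAverage {f : ℂ → ℝ} (hf : Measurable f)
    (hfi : IntegrableOn f (Metric.ball 0 1)) :
    ∫ z in Metric.ball (0 : ℂ) 1, f z =
      2 * Real.pi * ∫ r in (0 : ℝ)..1, r * Real.circleAverage f 0 r := by
  set F : ℂ → ℝ := (Metric.ball 0 1).indicator f with hF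
  have hFm : Measurable F := hf.indicator measurableSet_ball
  have hFi : Integrable F := hfi.integrable_indicator measurableSet_ball
  have hsymm : Measurable (fun p : ℝ × ℝ => Complex.polarCoord.symm p) := by
    simp only [Complex.polarCoord_symm_apply]
    fun_prop
  have hGm : Measurable fun p : ℝ × ℝ => p.1 • F (Complex.polarCoord.symm p) :=
    measurable_fst.smul (hFm.comp hsymm)
  have hGi : IntegrableOn (fun p : ℝ × ℝ => p.1 • F (Complex.polarCoord.symm p))
      (Set.Ioi 0 ×ˢ Set.Ioo (-Real.pi) Real.pi) := by
    refine ⟨hGm.aestronglyMeasurable, ?_⟩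
    have h1 := hFi.2
    rw [hasFiniteIntegral_iff_enorm, ← Complex.lintegral_comp_polarCoord_symm] at h1
    rw [hasFiniteIntegral_iff_enorm]
    refine lt_of_le_of_lt (le_of_eq ?_) h1
    rw [polarCoord_target]
    refine setLIntegral_congr_fun (measurableSet_Ioi.prod measurableSet_Ioo) fun p hp => ?_
    rw [enorm_smul, Real.enorm_of_nonneg (le_of_lt hp.1), smul_eq_mul]
  have hcirc : ∀ r θ : ℝ, Complex.polarCoord.symm (r, θ) = circleMap 0 r θ := by
    intro r θ
    rw [Complex.polarCoord_symm_apply, circleMap_zero, Complex.exp_mul_I]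
    push_cast
    rfl
  rw [← integral_indicator measurableSet_ball, ← hF, ← Complex.integral_comp_polarCoord_symm,
    polarCoord_target, Measure.volume_eq_prod, setIntegral_prod _ hGi,
    intervalIntegral.integral_of_le zero_le_one, integral_Ioc_eq_integral_Ioo,
    ← integral_const_mul]
  rw [← Set.Ioi_inter_Iio (a := (0 : ℝ)), ← setIntegral_indicator measurableSet_Iio]
  refine setIntegral_congr_fun measurableSet_Ioi fun r (hr : 0 < r) => ?_
  simp only [hcirc, smul_eq_mul, Set.indicator, Set.mem_Iio, hF, Metric.mem_ball, dist_zero_right,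
    norm_circleMap_zero, abs_of_pos hr]
  split_ifs with h1
  · have hper : Function.Periodic (fun θ => f (circleMap 0 r θ)) (2 * Real.pi) := fun θ => by
      simp only [(periodic_circleMap 0 r) θ]
    have := hper.intervalIntegral_add_eq (-Real.pi) 0
    rw [zero_add, show -Real.pi + 2 * Real.pi = Real.pi by ring] at this
    rw [integral_const_mul, ← integral_Ioc_eq_integral_Ioo,
      ← intervalIntegral.integral_of_le (by linarith [Real.pi_pos]), this,
      Real.circleAverage_def, smul_eq_mul]
    field_simp
  · simp

lemma integral_mul_log_max (t : ℝ) (ht : 0 ≤ t) :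
    ∫ r in (0 : ℝ)..1, r * Real.log (max r t) =
      (Real.posLog t - max 0 (1 - t ^ 2) / 2) / 2 := by
  rcases le_total 1 t with h1 | h1
  · have : ∀ r ∈ Set.uIcc (0 : ℝ) 1, r * Real.log (max r t) = r * Real.log t := by
      intro r hr
      rw [Set.uIcc_of_le zero_le_one] at hr
      rw [max_eq_right (hr.2.trans h1)]
    rw [intervalIntegral.integral_congr this, intervalIntegral.integral_mul_const, integral_id,
      Real.posLog_eq_log (by rwa [abs_of_nonneg ht]), max_eq_left (by nlinarith)]
    ring
  · have e1 : Set.EqOn (fun r => r * Real.log t) (fun r => r * Real.log (max r t))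
        (Set.uIcc 0 t) := by
      intro r hr
      rw [Set.uIcc_of_le ht] at hr
      simp only [max_eq_right hr.2]
    have e2 : Set.EqOn (fun r => r * Real.log r) (fun r => r * Real.log (max r t))
        (Set.uIcc t 1) := by
      intro r hr
      rw [Set.uIcc_of_le h1] at hr
      simp only [max_eq_left hr.1]
    have i1 : IntervalIntegrable (fun r => r * Real.log t) volume 0 t :=
      (by fun_prop : Continuous fun r => r * Real.log t).intervalIntegrable _ _
    have i2 : IntervalIntegrable (fun r => r * Real.log r) volume t 1 :=
      Real.continuous_mul_log.intervalIntegrable _ _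
    have c2 : Continuous fun r : ℝ => r * (r * Real.log r) / 2 - r ^ 2 / 4 := by
      have := Real.continuous_mul_log
      fun_prop
    rw [← intervalIntegral.integral_add_adjacent_intervals
        (i1.congr (e1.mono Set.uIoc_subset_uIcc)) (i2.congr (e2.mono Set.uIoc_subset_uIcc)),
      ← intervalIntegral.integral_congr e1, ← intervalIntegral.integral_congr e2,
      intervalIntegral.integral_mul_const, integral_id,
      intervalIntegral.integral_eq_sub_of_hasDerivAt_of_le h1 c2.continuousOn ?_ i2,
      Real.posLog_eq_zero_iff _ |>.2 (by rwa [abs_of_nonneg ht]), max_eq_right (by nlinarith)]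
    · simp only [Real.log_one]
      ring
    · intro r hr
      have hr0 : r ≠ 0 := (ht.trans_lt hr.1).ne'
      have := (((hasDerivAt_id r).mul ((hasDerivAt_id r).mul (Real.hasDerivAt_log hr0))).div_const
        2).sub (((hasDerivAt_id r).pow 2).div_const 4)
      refine this.congr_deriv ?_
      simp only [id, Pi.mul_apply]
      field_simp
      ring

/-- The logarithmic potential of Lebesgue measure on the unit disk. -/
lemma setIntegral_log_norm_sub_ball (a : ℂ) :
    ∫ z in Metric.ball (0 : ℂ) 1, Real.log ‖z - a‖ =
      Real.pi * (Real.posLog ‖a‖ - max 0 (1 - ‖a‖ ^ 2) / 2) := by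
  rw [setIntegral_ball_eq_integral_circleAverage (by fun_prop)
    (integrableOn_log_norm_sub_ball a)]
  have h : ∀ r ∈ Set.uIoo (0 : ℝ) 1, r * Real.circleAverage (fun z => Real.log ‖z - a‖) 0 r =
      r * Real.log (max r ‖a‖) := by
    intro r hr
    rw [Set.uIoo_of_le zero_le_one] at hr
    have hr0 := hr.1
    rw [circleAverage_log_norm_sub_const_eq_log_radius_add_posLog hr0.ne', zero_sub, norm_neg]
    rcases le_total r ‖a‖ with h | h
    · rw [max_eq_right h, Real.posLog_eq_log, Real.log_mul (by positivity) (by linarith),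
        Real.log_inv]
      · ring
      · rw [abs_of_nonneg (by positivity), ← div_eq_inv_mul]
        exact (one_le_div hr0).2 h
    · rw [max_eq_left h, (Real.posLog_eq_zero_iff _).2, add_zero]
      rw [abs_of_nonneg (by positivity), ← div_eq_inv_mul]
      exact (div_le_one hr0).2 h
  rw [intervalIntegral.integral_congr_uIoo h, integral_mul_log_max _ (norm_nonneg a)]
  ring

/-- The areal analogue of Jensen's formula. -/
lemma log_bergmanNorm_C_mul_prod {ι : Type*} [Fintype ι] (a : ℂ) (ha : a ≠ 0) (α : ι → ℂ) :
    Real.log (bergmanNorm (C a * ∏ i, (X - C (α i)))) =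
      Real.log ‖a‖ + ∑ i, (Real.posLog ‖α i‖ - max 0 (1 - ‖α i‖ ^ 2) / 2) := by
  have hae : (fun z => Real.log ‖(C a * ∏ i, (X - C (α i))).eval z‖)
      =ᵐ[volume.restrict (Metric.ball 0 1)]
      fun z => Real.log ‖a‖ + ∑ i, Real.log ‖z - α i‖ := by
    refine ae_restrict_of_ae ?_
    filter_upwards [(Set.finite_range α).countable.ae_notMem volume] with z hz
    have hz' : ∀ i, z - α i ≠ 0 := fun i h => hz ⟨i, (sub_eq_zero.1 h).symm⟩
    rw [eval_mul, eval_C, eval_prod, norm_mul, norm_prod, Real.log_mul (norm_ne_zero_iff.2 ha)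
      (Finset.prod_ne_zero_iff.2 fun i _ => by simpa using hz' i), Real.log_prod]
    · simp
    · intro i _
      simpa using hz' i
  have hvol : (volume : Measure ℂ).real (Metric.ball 0 1) = Real.pi := by
    simp [Measure.real, Complex.volume_ball]
  rw [bergmanNorm, Real.log_exp, integral_congr_ae hae, integral_add,
    integral_finsetSum _ fun i _ => integrableOn_log_norm_sub_ball (α i)]
  · simp only [setIntegral_log_norm_sub_ball, ← Finset.mul_sum, integral_const, smul_eq_mul,
      MeasurableSet.univ, measureReal_restrict_apply, Set.univ_inter, hvol]
    rw [mul_add, ← mul_assoc, ← mul_assoc, one_div, inv_mul_cancel₀ Real.pi_ne_zero, one_mul,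
      one_mul]
  · exact integrableOn_const measure_ball_lt_top.ne
  · exact integrable_finsetSum _ fun i _ => integrableOn_log_norm_sub_ball (α i)

/-! ### Monic polynomials that are small on the circle off an arc -/

/-- The deviation `log⁺ |z| + max 0 (1 - |z|²)` of `z` from the unit circle: nonnegative, and zero
exactly on the circle. At each point at most one of the two summands is nonzero. -/
noncomputable def circleDeviation (z : ℂ) : ℝ :=
  Real.posLog ‖z‖ + max 0 (1 - ‖z‖ ^ 2)

lemma circleDeviation_nonneg (z : ℂ) : 0 ≤ circleDeviation z :=
  add_nonneg Real.posLog_nonneg (le_max_left _ _)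

lemma norm_geom_sum_le {w : ℂ} (hw : ‖w‖ = 1) {r : ℝ} (hr : 0 < r) (h : r ≤ ‖w - 1‖) (m : ℕ) :
    ‖∑ j ∈ Finset.range m, w ^ j‖ ≤ 2 / r := by
  have h1 : w ≠ 1 := by
    rintro rfl
    simp at h
    linarith
  rw [geom_sum_eq h1, norm_div]
  gcongr
  calc ‖w ^ m - 1‖ ≤ ‖w ^ m‖ + ‖(1 : ℂ)‖ := norm_sub_le _ _
    _ = 2 := by simp [hw]; norm_num

lemma re_div_one_sub {w : ℂ} (hw : ‖w‖ = 1) (h : w ≠ 1) : (w / (1 - w)).re = -1 / 2 := by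
  have h1 : w.re * w.re + w.im * w.im = 1 := by
    rw [← Complex.normSq_apply, Complex.normSq_eq_norm_sq, hw, one_pow]
  have h2 : w.re ≠ 1 := by
    intro h2
    apply h
    apply Complex.ext h2
    rw [h2] at h1
    simpa using h1
  have h3 : Complex.normSq (1 - w) = 2 * (1 - w.re) := by
    simp only [Complex.normSq_apply, Complex.sub_re, Complex.sub_im, Complex.one_re,
      Complex.one_im]
    linarith
  have h4 : 1 - w.re ≠ 0 := sub_ne_zero.2 h2.symm
  rw [Complex.div_re, h3]
  simp only [Complex.sub_re, Complex.sub_im, Complex.one_re, Complex.one_im]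
  field_simp
  linarith

/-- A Cesàro mean of the partial sums of `w / (1 - w)`: on the unit circle away from `1` its real
part is close to `-1 / 2`, although it vanishes at `0`. -/
lemma exists_polynomial_re_eval_le {r : ℝ} (hr : 0 < r) :
    ∃ g : ℂ[X], g.coeff 0 = 0 ∧ ∃ A > 0, ∀ w : ℂ, ‖w‖ = 1 → r ≤ ‖w - 1‖ →
      (g.eval w).re ≤ -1 / 4 ∧ ‖g.eval w‖ ≤ A := by
  -- `m > 8 / r²` makes the deviation of the Cesàro mean from `w / (1 - w)` at most `1 / 4`.
  obtain ⟨m, hm⟩ := exists_nat_gt (8 / r ^ 2)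
  have hm0 : (0 : ℝ) < m := lt_trans (by positivity) hm
  refine ⟨X * (C (m : ℂ)⁻¹ * ∑ j ∈ Finset.range m, ∑ k ∈ Finset.range j, X ^ k), by simp,
    1 / r + 1 / 4, by positivity, fun w hw hwr => ?_⟩
  have h1 : w ≠ 1 := by
    rintro rfl
    simp at hwr
    linarith
  have h1' : 1 - w ≠ 0 := sub_ne_zero.2 h1.symm
  have hmC : (m : ℂ) ≠ 0 := by exact_mod_cast hm0.ne'
  set S := ∑ j ∈ Finset.range m, w ^ j with hS
  have heval : (X * (C (m : ℂ)⁻¹ * ∑ j ∈ Finset.range m, ∑ k ∈ Finset.range j, X ^ k)).eval w =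
      w / (1 - w) - w * S / ((1 - w) * m) := by
    simp only [eval_mul, eval_X, eval_C, eval_finsetSum, eval_pow]
    have : ∑ j ∈ Finset.range m, ∑ k ∈ Finset.range j, w ^ k = (m - S) / (1 - w) := by
      have : ∀ j, ∑ k ∈ Finset.range j, w ^ k = (1 - w ^ j) / (1 - w) := fun j => by
        rw [geom_sum_eq h1, ← neg_div_neg_eq]
        ring
      simp only [this]
      rw [← Finset.sum_div, Finset.sum_sub_distrib]
      simp [hS]
    rw [this]
    field_simp
  have hrr : r ≤ ‖1 - w‖ := by rwa [norm_sub_rev]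
  have herr : ‖w * S / ((1 - w) * m)‖ ≤ 1 / 4 := by
    rw [norm_div, norm_mul, norm_mul, hw, one_mul, Complex.norm_natCast]
    calc ‖S‖ / (‖1 - w‖ * m) ≤ (2 / r) / (r * m) := by
          gcongr
          exact norm_geom_sum_le hw hr hwr m
      _ ≤ 1 / 4 := by
          rw [div_lt_iff₀ (by positivity)] at hm
          rw [div_div, div_le_div_iff₀ (by positivity) (by norm_num)]
          nlinarith
  rw [heval]
  constructor
  · rw [Complex.sub_re, re_div_one_sub hw h1]
    have := (abs_le.1 ((Complex.abs_re_le_norm _).trans herr)).1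
    linarith
  · refine (norm_sub_le _ _).trans (add_le_add ?_ herr)
    rw [norm_div, hw]
    gcongr

/-- Perturb the constant `1` in the direction in which the real part decreases:
`|1 + ε g|² = 1 + 2 ε Re g + O(ε²)`. -/
lemma exists_polynomial_norm_eval_le {r : ℝ} (hr : 0 < r) :
    ∃ f : ℂ[X], f.coeff 0 = 1 ∧ ∃ ρ < 1, ∀ w : ℂ, ‖w‖ = 1 → r ≤ ‖w - 1‖ →
      ‖f.eval w‖ ≤ ρ := by
  obtain ⟨g, hg0, A, hA, hg⟩ := exists_polynomial_re_eval_le hr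
  set ε : ℝ := 1 / (4 * A ^ 2) with hε
  have hε0 : 0 < ε := by positivity
  refine ⟨1 + C (ε : ℂ) * g, by simp [hg0], √(1 - ε / 4), ?_, fun w hw hwr => ?_⟩
  · rw [Real.sqrt_lt' one_pos]
    linarith
  · obtain ⟨h1, h2⟩ := hg w hw hwr
    apply Real.le_sqrt_of_sq_le
    have h3 : ‖g.eval w‖ ^ 2 ≤ A ^ 2 := by gcongr
    rw [← Complex.normSq_eq_norm_sq, Complex.normSq_apply] at h3 ⊢
    simp only [eval_add, eval_one, eval_mul, eval_C, Complex.add_re, Complex.add_im,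
      Complex.one_re, Complex.one_im, Complex.re_ofReal_mul, Complex.im_ofReal_mul]
    have h4 : ε * A ^ 2 = 1 / 4 := by
      rw [hε]
      field_simp
    nlinarith [mul_le_mul_of_nonneg_left h3 (sq_nonneg ε), mul_le_mul_of_nonneg_left h1 hε0.le]

/-- The complement of an arc in the unit circle has capacity less than `1`. The polynomial is the
reverse of the one in `exists_polynomial_norm_eval_le`, rotated to `ζ`; reversing preserves absolute
values on the circle up to `z ↦ z⁻¹` and turns the constant coefficient into the leading one. -/
lemma exists_monic_norm_eval_le {ζ : ℂ} (hζ : ‖ζ‖ = 1) {r : ℝ} (hr : 0 < r) :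
    ∃ q : ℂ[X], q.Monic ∧ 0 < q.natDegree ∧ ∃ ρ < 1, ∀ z : ℂ, ‖z‖ = 1 → r ≤ ‖z - ζ‖ →
      ‖q.eval z‖ ≤ ρ := by
  obtain ⟨f, hf0, ρ, hρ, hf⟩ := exists_polynomial_norm_eval_le hr
  set F : ℂ[X] := f.comp (C ζ * X) with hF
  have hF0 : F.coeff 0 = 1 := by
    rw [coeff_zero_eq_eval_zero, hF, eval_comp]
    simp [← coeff_zero_eq_eval_zero, hf0]
  have hFm : F.reverse.Monic := by
    rw [Monic, reverse_leadingCoeff, trailingCoeff, natTrailingDegree_eq_zero.2, hF0]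
    right
    simp [hF0]
  -- The factor `X` keeps the degree positive.
  refine ⟨X * F.reverse, monic_X.mul hFm, ?_, ρ, hρ, fun z hz hzr => ?_⟩
  · rw [monic_X.natDegree_mul hFm, natDegree_X]
    omega
  · have hz0 : z ≠ 0 := by
      rintro rfl
      simp at hz
    let _ := invertibleOfNonzero (inv_ne_zero hz0)
    have h1 := congrArg norm (eval₂_reverse_mul_pow (RingHom.id ℂ) z⁻¹ F)
    rw [invOf_eq_inv, inv_inv, norm_mul, norm_pow, norm_inv, hz, inv_one, one_pow, mul_one] at h1
    have h2 : ‖ζ * z⁻¹ - 1‖ = ‖z - ζ‖ := by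
      have : ζ * z⁻¹ - 1 = -((z - ζ) * z⁻¹) := by
        field_simp
        ring
      rw [this, norm_neg, norm_mul, norm_inv, hz, inv_one, mul_one]
    have h3 := hf (ζ * z⁻¹) (by rw [norm_mul, norm_inv, hz, hζ, inv_one, mul_one])
      (by rwa [h2])
    rw [eval_mul, eval_X, norm_mul, hz, one_mul, eval, h1, hF, ← eval, eval_comp]
    simpa using h3

lemma norm_eval_le_mul_max_pow (q : ℂ[X]) :
    ∃ B : ℝ, 1 ≤ B ∧ ∀ z : ℂ, ‖q.eval z‖ ≤ B * max 1 ‖z‖ ^ q.natDegree := by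
  refine ⟨1 + ∑ i ∈ Finset.range (q.natDegree + 1), ‖q.coeff i‖,
    le_add_of_nonneg_right (Finset.sum_nonneg fun _ _ => norm_nonneg _), fun z => ?_⟩
  have h1 : (1 : ℝ) ≤ max 1 ‖z‖ := le_max_left _ _
  rw [eval_eq_sum_range]
  calc ‖∑ i ∈ Finset.range (q.natDegree + 1), q.coeff i * z ^ i‖
      ≤ ∑ i ∈ Finset.range (q.natDegree + 1), ‖q.coeff i * z ^ i‖ := norm_sum_le _ _
    _ ≤ ∑ i ∈ Finset.range (q.natDegree + 1), ‖q.coeff i‖ * max 1 ‖z‖ ^ q.natDegree := by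
        refine Finset.sum_le_sum fun i hi => ?_
        rw [norm_mul, norm_pow]
        gcongr
        calc ‖z‖ ^ i ≤ max 1 ‖z‖ ^ i := by
              gcongr
              exact le_max_right _ _
          _ ≤ _ := pow_le_pow_right₀ h1 (Nat.lt_succ_iff.1 (Finset.mem_range.1 hi))
    _ ≤ _ := by
        rw [← Finset.sum_mul]
        gcongr
        linarith

lemma abs_norm_sub_one_lt_of_circleDeviation_lt {z : ℂ} {δ : ℝ} (hδ : 0 < δ)
    (h : circleDeviation z < Real.log (1 + δ)) : |‖z‖ - 1| < δ := by
  have hlog : Real.log (1 + δ) ≤ δ := by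
    linarith [Real.log_le_sub_one_of_pos (show 0 < 1 + δ by linarith)]
  have h1 := le_max_left (0 : ℝ) (1 - ‖z‖ ^ 2)
  have h2 := le_max_right (0 : ℝ) (1 - ‖z‖ ^ 2)
  have h3 := Real.posLog_nonneg (x := ‖z‖)
  have h5 := norm_nonneg z
  rw [circleDeviation] at h
  rw [abs_lt]
  constructor
  · by_contra! hc
    nlinarith
  · by_contra! hc
    have : Real.log (1 + δ) ≤ Real.log ‖z‖ := Real.log_le_log (by linarith) (by linarith)
    have h4 : Real.log ‖z‖ ≤ Real.posLog ‖z‖ := le_max_right _ _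
    linarith

lemma max_one_norm_le_exp (z : ℂ) : max 1 ‖z‖ ≤ Real.exp (circleDeviation z) := by
  have h1 := circleDeviation_nonneg z
  have h2 : Real.posLog ‖z‖ ≤ circleDeviation z := le_add_of_nonneg_right (le_max_left _ _)
  refine max_le (Real.one_le_exp h1) ?_
  rcases (norm_nonneg z).eq_or_lt with h | h
  · rw [← h]
    positivity
  · rw [← Real.log_le_iff_le_exp h]
    exact (le_max_right _ _ : Real.log ‖z‖ ≤ Real.posLog ‖z‖).trans h2

/-- The polynomial of `exists_monic_norm_eval_le` is controlled off the disk around `ζ` by the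
distance to the circle. -/
lemma exists_monic_norm_eval_le_exp {ζ : ℂ} (hζ : ‖ζ‖ = 1) {r : ℝ} (hr : 0 < r) :
    ∃ q : ℂ[X], q.Monic ∧ 0 < q.natDegree ∧ ∃ κ > 0, ∃ K : ℝ, 0 ≤ K ∧
      ∀ z : ℂ, r ≤ ‖z - ζ‖ → ‖q.eval z‖ ≤ Real.exp (-κ + K * circleDeviation z) := by
  obtain ⟨q, hq, hd, ρ, hρ, hqρ⟩ := exists_monic_norm_eval_le hζ hr
  obtain ⟨B, hB1, hB⟩ := norm_eval_le_mul_max_pow q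
  obtain ⟨ρ', hρ', hρ'1⟩ := exists_between (max_lt hρ one_half_lt_one)
  have hρ'0 : 0 < ρ' := lt_trans (by norm_num) ((le_max_right _ _).trans_lt hρ')
  have hρρ' : ρ < ρ' := (le_max_left _ _).trans_lt hρ'
  have hU : IsOpen ({z : ℂ | ‖q.eval z‖ < ρ'} ∪ Metric.ball ζ r) :=
    (isOpen_lt (by fun_prop) continuous_const).union Metric.isOpen_ball
  have hsub : Metric.sphere (0 : ℂ) 1 ⊆ {z : ℂ | ‖q.eval z‖ < ρ'} ∪ Metric.ball ζ r := by
    intro z hz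
    by_cases h : z ∈ Metric.ball ζ r
    · exact Or.inr h
    · left
      rw [Metric.mem_ball, dist_eq_norm, not_lt] at h
      exact (hqρ z (by simpa using hz) h).trans_lt hρρ'
  obtain ⟨δ, hδ, hδU⟩ := (isCompact_sphere (0 : ℂ) 1).exists_thickening_subset_open hU hsub
  set τ := Real.log (1 + min δ 1) with hτ
  have hm : 0 < min δ 1 := lt_min hδ one_pos
  have hτ0 : 0 < τ := Real.log_pos (by linarith)
  set κ := -Real.log ρ' with hκ
  have hκ0 : 0 < κ := neg_pos.2 (Real.log_neg hρ'0 hρ'1)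
  have hlB : 0 ≤ Real.log B := Real.log_nonneg hB1
  refine ⟨q, hq, hd, κ, hκ0, (Real.log B + κ) / τ + q.natDegree, by positivity,
    fun z hz => ?_⟩
  have ht := circleDeviation_nonneg z
  rcases lt_or_ge (circleDeviation z) τ with h | h
  · have h1 := abs_norm_sub_one_lt_of_circleDeviation_lt hm h
    have hz0 : z ≠ 0 := by
      rintro rfl
      have := min_le_right δ 1
      simp at h1
    have hz0' : ‖z‖ ≠ 0 := norm_ne_zero_iff.2 hz0
    have hzU : z ∈ {z : ℂ | ‖q.eval z‖ < ρ'} ∪ Metric.ball ζ r := by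
      refine hδU (Metric.mem_thickening_iff.2 ⟨z / ‖z‖, ?_, ?_⟩)
      · simp [hz0']
      · rw [dist_eq_norm]
        have : z - z / ‖z‖ = (z / ‖z‖) * ((‖z‖ - 1 : ℝ) : ℂ) := by
          have : (‖z‖ : ℂ) ≠ 0 := by exact_mod_cast hz0'
          push_cast
          field_simp
        rw [this, norm_mul, norm_div, Complex.norm_real, norm_norm, div_self hz0', one_mul,
          Complex.norm_real, Real.norm_eq_abs]
        exact h1.trans_le (min_le_left _ _)
    rcases hzU with hzU | hzU
    · calc ‖q.eval z‖ ≤ ρ' := le_of_lt hzU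
        _ = Real.exp (-κ) := by rw [hκ, neg_neg, Real.exp_log hρ'0]
        _ ≤ _ := Real.exp_le_exp.2 (le_add_of_nonneg_right (by positivity))
    · rw [Metric.mem_ball, dist_eq_norm] at hzU
      linarith
  · calc ‖q.eval z‖ ≤ B * max 1 ‖z‖ ^ q.natDegree := hB z
      _ ≤ Real.exp (Real.log B) * Real.exp (circleDeviation z) ^ q.natDegree := by
          rw [Real.exp_log (by linarith)]
          gcongr
          exact max_one_norm_le_exp z
      _ = Real.exp (Real.log B + q.natDegree * circleDeviation z) := by
          rw [Real.exp_add, Real.exp_nat_mul]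
      _ ≤ _ := by
          rw [Real.exp_le_exp, add_mul, div_mul_eq_mul_div]
          have : Real.log B + κ ≤ (Real.log B + κ) * circleDeviation z / τ := by
            rw [le_div_iff₀ hτ0]
            gcongr
          linarith

/-! ### An upper bound for Vandermonde determinants -/

/-- A bound for the determinant from Leibniz's formula. Row and column factors both come out as
products, so a few large rows cannot spoil the decay along the columns, as they would in Hadamard's
inequality for columns. -/
lemma norm_det_le_factorial_mul_exp {n : ℕ} (M : Matrix (Fin n) (Fin n) ℂ) (u v : Fin n → ℝ)
    (h : ∀ i j, ‖M i j‖ ≤ Real.exp (u i + v j)) :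
    ‖M.det‖ ≤ n.factorial * Real.exp (∑ i, u i + ∑ j, v j) := by
  rw [Matrix.det_apply]
  calc ‖∑ σ : Equiv.Perm (Fin n), Equiv.Perm.sign σ • ∏ i, M (σ i) i‖
      ≤ ∑ σ : Equiv.Perm (Fin n), ‖Equiv.Perm.sign σ • ∏ i, M (σ i) i‖ := norm_sum_le _ _
    _ ≤ ∑ _σ : Equiv.Perm (Fin n), Real.exp (∑ i, u i + ∑ j, v j) := by
        refine Finset.sum_le_sum fun σ _ => ?_
        have h1 : ‖Equiv.Perm.sign σ • ∏ i, M (σ i) i‖ = ∏ i, ‖M (σ i) i‖ := by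
          rcases Int.units_eq_one_or (Equiv.Perm.sign σ) with h | h <;> simp [h]
        rw [h1]
        calc ∏ i, ‖M (σ i) i‖ ≤ ∏ i, Real.exp (u (σ i) + v i) :=
              Finset.prod_le_prod (fun _ _ => norm_nonneg _) fun i _ => h _ _
          _ = _ := by
              rw [← Real.exp_sum, Finset.sum_add_distrib, Equiv.sum_comp σ u]
    _ = _ := by
        simp [Fintype.card_perm]

lemma norm_eval_pow_div_mul_X_pow_mod_le {q : ℂ[X]} (hd : 0 < q.natDegree) {κ K : ℝ} (hκ : 0 < κ)
    (hK : 0 ≤ K) {z : ℂ} (hz : ‖q.eval z‖ ≤ Real.exp (-κ + K * circleDeviation z))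
    {k n : ℕ} (hk : k < n) :
    ‖(q ^ (k / q.natDegree) * X ^ (k % q.natDegree)).eval z‖ ≤
      Real.exp ((K + q.natDegree) * n * circleDeviation z +
        κ * (1 - k / (q.natDegree : ℝ))) := by
  set d := q.natDegree with hd_def
  have hd' : (0 : ℝ) < d := by exact_mod_cast hd
  have ht := circleDeviation_nonneg z
  have h1 : (k : ℝ) / d - 1 ≤ (k / d : ℕ) := by
    have h2 : (k : ℝ) = d * (k / d : ℕ) + (k % d : ℕ) := by
      exact_mod_cast (Nat.div_add_mod k d).symm
    have h3 : ((k % d : ℕ) : ℝ) ≤ d := by exact_mod_cast (Nat.mod_lt k hd).le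
    rw [sub_le_iff_le_add, div_le_iff₀ hd']
    linarith
  have h2 : ((k / d : ℕ) : ℝ) ≤ n := by exact_mod_cast (Nat.div_le_self k d).trans hk.le
  have h3 : ((k % d : ℕ) : ℝ) ≤ d * n := by
    exact_mod_cast (Nat.mod_lt k hd).le.trans (Nat.le_mul_of_pos_right d (by omega))
  rw [eval_mul, eval_pow, eval_pow, eval_X, norm_mul, norm_pow, norm_pow]
  calc ‖q.eval z‖ ^ (k / d) * ‖z‖ ^ (k % d)
      ≤ Real.exp (-κ + K * circleDeviation z) ^ (k / d) *
          Real.exp (circleDeviation z) ^ (k % d) := by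
        gcongr
        exact (le_max_right _ _).trans (max_one_norm_le_exp z)
    _ = Real.exp ((k / d : ℕ) * (-κ + K * circleDeviation z) +
          (k % d : ℕ) * circleDeviation z) := by
        rw [← Real.exp_nat_mul, ← Real.exp_nat_mul, ← Real.exp_add]
    _ ≤ _ := by
        rw [Real.exp_le_exp]
        have e1 := mul_le_mul_of_nonneg_left h1 hκ.le
        have e2 := mul_le_mul_of_nonneg_right h2 (mul_nonneg hK ht)
        have e3 := mul_le_mul_of_nonneg_right h3 ht
        nlinarith

/-- If points avoid the disk around `ζ` and lie on average near the unit circle, then their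
Vandermonde determinant is exponentially small in the square of their number: pass to the basis
`q ^ (k / d) * X ^ (k % d)` of monic polynomials and expand the determinant. -/
lemma norm_det_vandermonde_le {q : ℂ[X]} (hq : q.Monic) (hd : 0 < q.natDegree) {κ K : ℝ}
    (hκ : 0 < κ) (hK : 0 ≤ K) {n : ℕ} (α : Fin n → ℂ)
    (hα : ∀ i, ‖q.eval (α i)‖ ≤ Real.exp (-κ + K * circleDeviation (α i))) :
    ‖(Matrix.vandermonde α).det‖ ≤ n.factorial *
      Real.exp ((K + q.natDegree) * n * ∑ i, circleDeviation (α i) +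
        κ * (n - n * (n - 1) / (2 * q.natDegree))) := by
  have hd' : (q.natDegree : ℝ) ≠ 0 := by exact_mod_cast hd.ne'
  rw [Matrix.det_eval_matrixOfPolynomials_eq_det_vandermonde α
    (fun k => q ^ ((k : ℕ) / q.natDegree) * X ^ ((k : ℕ) % q.natDegree)) ?_
    fun k => (hq.pow _).mul (monic_X_pow _)]
  · refine (norm_det_le_factorial_mul_exp _
      (fun i => (K + q.natDegree) * n * circleDeviation (α i))
      (fun k => κ * (1 - (k : ℕ) / (q.natDegree : ℝ)))
      fun i k => norm_eval_pow_div_mul_X_pow_mod_le hd hκ hK (hα i) k.2).trans_eq ?_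
    have hsum : ∑ k : Fin n, ((k : ℕ) : ℝ) = n * (n - 1) / 2 := by
      rw [Fin.sum_univ_eq_sum_range (fun k => (k : ℝ)) n]
      clear hα α
      induction n with
      | zero => simp
      | succ n ih =>
        rw [Finset.sum_range_succ, ih]
        push_cast
        ring
    rw [← Finset.mul_sum, ← Finset.mul_sum, Finset.sum_sub_distrib, ← Finset.sum_div, hsum]
    simp only [Finset.sum_const, Finset.card_univ, Fintype.card_fin, nsmul_eq_mul, mul_one]
    congr 4
    field_simp
  · intro k
    rw [(hq.pow _).natDegree_mul (monic_X_pow _), hq.natDegree_pow, natDegree_X_pow]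
    exact Nat.div_add_mod' _ _

/-! ### Integrality -/

lemma prod_prod_erase_norm_sub_eq_sq_norm_det_vandermonde {n : ℕ} (α : Fin n → ℂ) :
    ∏ i, ∏ j ∈ Finset.univ.erase i, ‖α i - α j‖ = ‖(Matrix.vandermonde α).det‖ ^ 2 := by
  have h := Finset.prod_prod_Ioi_mul_eq_prod_prod_off_diag (fun i j => ‖α j - α i‖)
  rw [Matrix.det_vandermonde, norm_prod, ← Finset.prod_pow]
  simp only [norm_prod, ← Finset.prod_pow]
  rw [Finset.prod_congr rfl fun i _ => Finset.prod_congr (Finset.compl_singleton i).symm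
    fun _ _ => rfl, ← h]
  refine Finset.prod_congr rfl fun i _ => Finset.prod_congr rfl fun j _ => ?_
  rw [norm_sub_rev (α i), sq]

/-- The resultant of `P` and its derivative is a nonzero integer. -/
lemma one_le_norm_pow_mul_norm_det_vandermonde {P : ℤ[X]} {n : ℕ} (hn : P.natDegree = n)
    (hn0 : 0 < n) {a : ℂ} (ha : a ≠ 0) {α : Fin n → ℂ} (hα : Function.Injective α)
    (hP : P.map (Int.castRingHom ℂ) = C a * ∏ i, (X - C (α i))) :
    1 ≤ ‖a‖ ^ (2 * n - 1) * ‖(Matrix.vandermonde α).det‖ ^ 2 := by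
  set Q := P.map (Int.castRingHom ℂ) with hQ
  have hQn : Q.natDegree = n := by
    rw [hQ, natDegree_map_eq_of_injective (RingHom.injective_int _), hn]
  have hroots : Q.roots = Finset.univ.val.map α := by
    have : ∏ i, (X - C (α i)) =
        (Multiset.map (fun z => X - C z) (Finset.univ.val.map α)).prod := by
      rw [Multiset.map_map]
      rfl
    rw [hP, roots_C_mul _ ha, this, roots_multiset_prod_X_sub_C]
  have hlead : Q.leadingCoeff = a := by
    rw [hP, leadingCoeff_mul, leadingCoeff_C, (monic_prod_of_monic _ _ fun i _ =>
      monic_X_sub_C (α i)).leadingCoeff, mul_one]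
  have hder : ∀ i, Q.derivative.eval (α i) = a * ∏ j ∈ Finset.univ.erase i, (α i - α j) := by
    intro i
    rw [hP, derivative_C_mul, eval_mul, eval_C, derivative_prod_finset, eval_finsetSum,
      Finset.sum_eq_single i]
    · simp [eval_prod]
    · intro j _ hj
      rw [eval_mul, eval_prod,
        Finset.prod_eq_zero (Finset.mem_erase.2 ⟨hj.symm, Finset.mem_univ i⟩) (by simp), zero_mul]
    · simp
  have hres : ((resultant P P.derivative n (n - 1) : ℤ) : ℂ) =
      a ^ (n - 1) * ∏ i, (a * ∏ j ∈ Finset.univ.erase i, (α i - α j)) := by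
    have h1 := resultant_map_map P P.derivative n (n - 1) (Int.castRingHom ℂ)
    have h2 := resultant_eq_prod_eval Q Q.derivative (n - 1)
      (by rw [← hQn]; exact natDegree_derivative_le Q) (IsAlgClosed.splits Q)
    rw [hQn, hlead, hroots, Multiset.map_map] at h2
    rw [← eq_intCast (Int.castRingHom ℂ), ← h1, ← derivative_map, ← hQ, h2,
      Finset.prod_eq_multiset_prod]
    simp only [Function.comp_def, hder]
  have hne : resultant P P.derivative n (n - 1) ≠ 0 := by
    intro h0
    rw [h0, Int.cast_zero, eq_comm] at hres
    revert hres
    refine mul_ne_zero (pow_ne_zero _ ha) (Finset.prod_ne_zero_iff.2 fun i _ =>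
      mul_ne_zero ha (Finset.prod_ne_zero_iff.2 fun j hj => sub_ne_zero.2 fun h => ?_))
    exact (Finset.mem_erase.1 hj).1 (hα h).symm
  have h1 : (1 : ℝ) ≤ ‖((resultant P P.derivative n (n - 1) : ℤ) : ℂ)‖ := by
    rw [Complex.norm_intCast]
    exact_mod_cast Int.one_le_abs hne
  rw [hres, norm_mul, norm_prod, norm_pow] at h1
  simp only [norm_mul, norm_prod, Finset.prod_mul_distrib, Finset.prod_const, Finset.card_univ,
    Fintype.card_fin, prod_prod_erase_norm_sub_eq_sq_norm_det_vandermonde] at h1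
  rwa [← mul_assoc, ← pow_add, show n - 1 + n = 2 * n - 1 by omega] at h1

/-- A factor `X` of the product has trailing coefficient `1`, in agreement with `Real.log 0 = 0`. -/
lemma log_norm_trailingCoeff_prod_X_sub_C {ι : Type*} (s : Finset ι) (α : ι → ℂ) :
    Real.log ‖(∏ i ∈ s, (X - C (α i))).trailingCoeff‖ = ∑ i ∈ s, Real.log ‖α i‖ := by
  classical
  induction s using Finset.induction_on with
  | empty => simp [trailingCoeff]
  | insert i s hi ih =>
    have hne : (X - C (α i)).trailingCoeff ≠ 0 := trailingCoeff_eq_zero.not.2 (X_sub_C_ne_zero _)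
    have hne' : (∏ i ∈ s, (X - C (α i))).trailingCoeff ≠ 0 :=
      trailingCoeff_eq_zero.not.2 (Finset.prod_ne_zero_iff.2 fun j _ => X_sub_C_ne_zero _)
    rw [Finset.prod_insert hi, Finset.sum_insert hi, trailingCoeff_mul, norm_mul,
      Real.log_mul (norm_ne_zero_iff.2 hne) (norm_ne_zero_iff.2 hne'), ih]
    congr 1
    by_cases h : α i = 0
    · simp [h, trailingCoeff, natTrailingDegree_X]
    · have h0 : (X - C (α i)).coeff 0 ≠ 0 := by simpa using h
      rw [trailingCoeff, natTrailingDegree_eq_zero.2 (Or.inr h0)]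
      simp

/-- The lowest nonzero coefficient of `P` is a nonzero integer. The convention `Real.log 0 = 0`
discards a zero of `P` at the origin. -/
lemma log_norm_add_sum_log_norm_nonneg {P : ℤ[X]} {ι : Type*} [Fintype ι] {a : ℂ} (ha : a ≠ 0)
    {α : ι → ℂ} (hP : P.map (Int.castRingHom ℂ) = C a * ∏ i, (X - C (α i))) :
    0 ≤ Real.log ‖a‖ + ∑ i, Real.log ‖α i‖ := by
  have hprod : (∏ i, (X - C (α i))) ≠ 0 := Finset.prod_ne_zero_iff.2 fun j _ => X_sub_C_ne_zero _
  have h1 : (C a * ∏ i, (X - C (α i))).trailingCoeff ≠ 0 :=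
    trailingCoeff_eq_zero.not.2 (mul_ne_zero (C_ne_zero.2 ha) hprod)
  have h2 := congrArg (fun z => Real.log ‖z‖) (trailingCoeff_mul (C a) (∏ i, (X - C (α i))))
  simp only [norm_mul] at h2
  rw [Real.log_mul (norm_ne_zero_iff.2 (trailingCoeff_eq_zero.not.2 (C_ne_zero.2 ha)))
    (norm_ne_zero_iff.2 (trailingCoeff_eq_zero.not.2 hprod)),
    log_norm_trailingCoeff_prod_X_sub_C] at h2
  have h3 : (C a).trailingCoeff = a := by simp [trailingCoeff]
  rw [h3] at h2
  rw [← h2]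
  apply Real.log_nonneg
  rw [← hP, trailingCoeff, coeff_map, eq_intCast] at h1 ⊢
  rw [Complex.norm_intCast]
  exact_mod_cast Int.one_le_abs (Int.cast_ne_zero.1 h1)

lemma log_norm_leading_nonneg {P : ℤ[X]} {ι : Type*} [Fintype ι] {a : ℂ} (ha : a ≠ 0)
    {α : ι → ℂ} (hP : P.map (Int.castRingHom ℂ) = C a * ∏ i, (X - C (α i))) :
    0 ≤ Real.log ‖a‖ := by
  have hlead : (P.map (Int.castRingHom ℂ)).leadingCoeff = a := by
    rw [hP, leadingCoeff_mul, leadingCoeff_C, (monic_prod_of_monic _ _ fun i _ =>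
      monic_X_sub_C (α i)).leadingCoeff, mul_one]
  apply Real.log_nonneg
  rw [leadingCoeff, coeff_map, eq_intCast] at hlead
  rw [← hlead] at ha ⊢
  rw [Complex.norm_intCast]
  exact_mod_cast Int.one_le_abs (Int.cast_ne_zero.1 ha)

lemma exists_injective_eq_C_mul_prod_X_sub_C {Q : ℂ[X]} {n : ℕ} (hn : Q.natDegree = n)
    (hQ : ∀ z, Q.IsRoot z → Q.rootMultiplicity z = 1) :
    ∃ α : Fin n → ℂ, Function.Injective α ∧
      Q = C Q.leadingCoeff * ∏ i, (X - C (α i)) := by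
  have hnodup : Q.roots.Nodup := by
    rw [Multiset.nodup_iff_count_le_one]
    intro z
    by_cases hz : z ∈ Q.roots
    · rw [count_roots, hQ z (isRoot_of_mem_roots hz)]
    · rw [Multiset.count_eq_zero_of_notMem hz]
      exact zero_le_one
  have hsp := IsAlgClosed.splits Q
  have hcard : Q.roots.toFinset.card = n := by
    rw [Multiset.toFinset_card_of_nodup hnodup, ← hn, hsp.natDegree_eq_card_roots]
  refine ⟨fun i => (Q.roots.toFinset.equivFinOfCardEq hcard).symm i,
    Subtype.val_injective.comp (Equiv.injective _), ?_⟩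
  rw [Equiv.prod_comp (Q.roots.toFinset.equivFinOfCardEq hcard).symm
    (fun z => X - C (z : ℂ)), Finset.prod_coe_sort _ (fun z : ℂ => X - C z),
    Finset.prod_eq_multiset_prod, Multiset.toFinset_val, hnodup.dedup]
  exact hsp.eq_prod_roots

/-! ### The lower bound for the Bergman norm -/

/-- The contribution of a zero `z` to Jensen's formula for the area measure exceeds `log ‖z‖` by at
least a quarter of the square of `max 0 (1 - ‖z‖²)`. The summand at `z = 0` compensates for
`Real.log 0 = 0`. -/
lemma sq_max_div_four_le (z : ℂ) :
    max 0 (1 - ‖z‖ ^ 2) ^ 2 / 4 ≤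
      Real.posLog ‖z‖ - max 0 (1 - ‖z‖ ^ 2) / 2 - Real.log ‖z‖ + if z = 0 then 1 else 0 := by
  by_cases hz : z = 0
  · simp [hz, Real.posLog]
    norm_num
  rw [if_neg hz, add_zero]
  have hz0 : 0 < ‖z‖ := norm_pos_iff.2 hz
  rcases le_total 1 ‖z‖ with h | h
  · rw [max_eq_left (by nlinarith), Real.posLog_eq_log (by rwa [abs_of_pos hz0])]
    norm_num
  · have hs : 0 ≤ 1 - ‖z‖ ^ 2 := by nlinarith
    rw [max_eq_right hs, (Real.posLog_eq_zero_iff _).2 (by rwa [abs_of_pos hz0])]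
    -- `-log (1 - s) ≥ s + s² / 2` for `s = 1 - ‖z‖²`, from the Taylor series.
    have h1 := Real.hasSum_pow_div_log_of_abs_lt_one (x := 1 - ‖z‖ ^ 2)
      (by rw [abs_of_nonneg hs]; nlinarith)
    have h2 := sum_le_hasSum (Finset.range 2) (fun i _ => by positivity) h1
    rw [sub_sub_cancel, Real.log_pow] at h2
    simp [Finset.sum_range_succ] at h2
    linarith

/-- If `log ‖P‖₀` is small, the zeros of `P` are on average close to the unit circle. The parameter
`β` comes from `s ≤ β + s² / (4β)`, which turns a bound for `∑ s²` into one for `∑ s`. -/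
lemma sum_circleDeviation_le {P : ℤ[X]} {n : ℕ} {a : ℂ} (ha : a ≠ 0) {α : Fin n → ℂ}
    (hα : Function.Injective α) (hP : P.map (Int.castRingHom ℂ) = C a * ∏ i, (X - C (α i)))
    {L β : ℝ} (hβ : 0 < β) (hL : Real.log (bergmanNorm (P.map (Int.castRingHom ℂ))) = L) :
    Real.log ‖a‖ + ∑ i, circleDeviation (α i) ≤ L + 3 / 2 * (β * n + (L + 1) / β) := by
  rw [hP, log_bergmanNorm_C_mul_prod a ha α] at hL
  set s : Fin n → ℝ := fun i => max 0 (1 - ‖α i‖ ^ 2) with hs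
  have h0 : ∑ i, (if α i = 0 then (1 : ℝ) else 0) ≤ 1 := by
    rw [← Finset.sum_filter, Finset.sum_const, nsmul_eq_mul, mul_one]
    have : (Finset.univ.filter fun i => α i = 0).card ≤ 1 := by
      rw [Finset.card_le_one]
      intro i hi j hj
      exact hα ((Finset.mem_filter.1 hi).2.trans (Finset.mem_filter.1 hj).2.symm)
    exact_mod_cast this
  have h1 : ∑ i, s i ^ 2 / 4 ≤ L + 1 := by
    have h2 := Finset.sum_le_sum fun i (_ : i ∈ Finset.univ) => sq_max_div_four_le (α i)
    rw [Finset.sum_add_distrib, Finset.sum_sub_distrib] at h2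
    have h3 := log_norm_add_sum_log_norm_nonneg ha hP
    linarith
  have h2 : ∑ i, s i ≤ β * n + (L + 1) / β := by
    calc ∑ i, s i ≤ ∑ i, (β + s i ^ 2 / 4 / β) := by
          refine Finset.sum_le_sum fun i _ => ?_
          have : β + s i ^ 2 / 4 / β - s i = (β - s i / 2) ^ 2 / β := by
            field_simp
            ring
          have h3 : 0 ≤ (β - s i / 2) ^ 2 / β := by positivity
          linarith
      _ = β * n + (∑ i, s i ^ 2 / 4) / β := by
          rw [Finset.sum_add_distrib, Finset.sum_div]
          simp [mul_comm]
      _ ≤ _ := by gcongr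
  have h3 : ∑ i, circleDeviation (α i) =
      ∑ i, (Real.posLog ‖α i‖ - max 0 (1 - ‖α i‖ ^ 2) / 2) + 3 / 2 * ∑ i, s i := by
    rw [Finset.mul_sum, ← Finset.sum_add_distrib]
    refine Finset.sum_congr rfl fun i _ => ?_
    simp only [circleDeviation, hs]
    ring
  rw [h3]
  linarith

/-- Comparison of the integrality bound for the discriminant with the upper bound for the
Vandermonde determinant. -/
lemma le_of_eval_le_exp {P : ℤ[X]} {n : ℕ} (hn : P.natDegree = n) (hn0 : 0 < n) {a : ℂ}
    (ha : a ≠ 0) {α : Fin n → ℂ} (hα : Function.Injective α)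
    (hP : P.map (Int.castRingHom ℂ) = C a * ∏ i, (X - C (α i)))
    {q : ℂ[X]} (hq : q.Monic) (hd : 0 < q.natDegree) {κ K : ℝ} (hκ : 0 < κ) (hK : 0 ≤ K)
    (hqα : ∀ i, ‖q.eval (α i)‖ ≤ Real.exp (-κ + K * circleDeviation (α i))) {T : ℝ}
    (hT : Real.log ‖a‖ + ∑ i, circleDeviation (α i) ≤ T) :
    κ * (n - 1) / (2 * q.natDegree) ≤ (1 + K + q.natDegree) * T + Real.log n + κ := by
  have hn' : (0 : ℝ) < n := by exact_mod_cast hn0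
  have hd' : (0 : ℝ) < q.natDegree := by exact_mod_cast hd
  have hD := norm_det_vandermonde_le hq hd hκ hK α hqα
  have h1 := one_le_norm_pow_mul_norm_det_vandermonde hn hn0 ha hα hP
  have ha0 := log_norm_leading_nonneg ha hP
  set D := ‖(Matrix.vandermonde α).det‖ with hDdef
  set S := ∑ i, circleDeviation (α i) with hS
  have hS0 : 0 ≤ S := Finset.sum_nonneg fun i _ => circleDeviation_nonneg _
  have hDpos : 0 < D := by
    refine (norm_nonneg _).lt_of_ne fun h => ?_
    rw [hDdef, ← h] at h1
    norm_num at h1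
  have h2 : Real.log D ≤ n * Real.log n + ((K + q.natDegree) * n * S +
      κ * (n - n * (n - 1) / (2 * q.natDegree))) := by
    refine (Real.log_le_log hDpos hD).trans ?_
    have hf : (0 : ℝ) < n.factorial := by exact_mod_cast n.factorial_pos
    rw [Real.log_mul hf.ne' (Real.exp_pos _).ne', Real.log_exp, ← Real.log_pow]
    gcongr
    exact_mod_cast n.factorial_le_pow
  have h3 := Real.log_nonneg h1
  rw [Real.log_mul (pow_ne_zero _ (norm_ne_zero_iff.2 ha)) (by positivity), Real.log_pow,
    Real.log_pow] at h3
  have h4 : ((2 * n - 1 : ℕ) : ℝ) * Real.log ‖a‖ ≤ (2 * n) * Real.log ‖a‖ := by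
    gcongr
    exact_mod_cast Nat.sub_le _ _
  have h5 : 0 ≤ (n : ℝ) * (Real.log ‖a‖ + Real.log n + (K + q.natDegree) * S + κ -
      κ * (n - 1) / (2 * q.natDegree)) := by
    have : (n : ℝ) * (Real.log ‖a‖ + Real.log n + (K + q.natDegree) * S + κ -
      κ * (n - 1) / (2 * q.natDegree)) = n * Real.log ‖a‖ + (n * Real.log n +
      ((K + q.natDegree) * n * S + κ * (n - n * (n - 1) / (2 * q.natDegree)))) := by
      ring
    rw [this]
    push_cast at h3
    linarith
  have h6 := nonneg_of_mul_nonneg_right h5 hn'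
  have h7 : (K + q.natDegree) * S ≤ (K + q.natDegree) * T := by
    gcongr
    linarith
  linarith

/-- Simple zeros outside a disk centred on the unit circle force `‖P‖₀` to grow exponentially in the
degree, at a rate depending only on the disk. -/
lemma exists_eventually_mul_le_log_bergmanNorm {ζ : ℂ} (hζ : ‖ζ‖ = 1) {r : ℝ} (hr : 0 < r) :
    ∃ ε > 0, ∀ᶠ n : ℕ in atTop, ∀ P : ℤ[X], P.degree = n →
      (∀ z : ℂ, (P.map (Int.castRingHom ℂ)).IsRoot z →
        r ≤ ‖z - ζ‖ ∧ (P.map (Int.castRingHom ℂ)).rootMultiplicity z = 1) →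
      ε * n ≤ Real.log (bergmanNorm (P.map (Int.castRingHom ℂ))) := by
  obtain ⟨q, hq, hd, κ, hκ, K, hK, hqz⟩ := exists_monic_norm_eval_le_exp hζ hr
  set d := (q.natDegree : ℝ) with hd_def
  have hd' : 0 < d := Nat.cast_pos.2 hd
  -- `η` makes the error `(1 + K + d) η n` half of the main term `κ n / (2d)`; then `β` and `ε` make
  -- the deviation of the zeros from the circle at most `η n`.
  set η : ℝ := κ / (4 * d * (1 + K + d)) with hη
  have hη0 : 0 < η := by positivity
  set β : ℝ := 2 * η / 9 with hβ
  have hβ0 : 0 < β := by positivity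
  refine ⟨min (η / 6) (η * β / 9), by positivity, ?_⟩
  have e1 : ∀ᶠ n : ℕ in atTop, Real.log n ≤ κ / (16 * d) * n := by
    have := (Real.isLittleO_log_id_atTop.comp_tendsto
      tendsto_natCast_atTop_atTop).bound (show 0 < κ / (16 * d) by positivity)
    filter_upwards [this] with n hn
    refine (le_abs_self _).trans ?_
    simpa using hn
  have e2 : ∀ᶠ n : ℕ in atTop, max (9 / (2 * β * η)) ((κ + κ / (2 * d)) * (16 * d) / κ) ≤ n :=
    tendsto_natCast_atTop_atTop.eventually_ge_atTop _
  filter_upwards [e1, e2, eventually_gt_atTop 0] with n hn1 hn2 hn0 P hPn hPz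
  have hn' : (0 : ℝ) < n := by exact_mod_cast hn0
  by_contra! hL
  set Q := P.map (Int.castRingHom ℂ) with hQ
  have hnd : P.natDegree = n := natDegree_eq_of_degree_eq_some hPn
  have hQn : Q.natDegree = n := by
    rw [hQ, natDegree_map_eq_of_injective (RingHom.injective_int _), hnd]
  have hQ0 : Q.leadingCoeff ≠ 0 := by
    rw [Ne, leadingCoeff_eq_zero]
    intro h
    rw [h, natDegree_zero] at hQn
    omega
  obtain ⟨α, hα, hQα⟩ := exists_injective_eq_C_mul_prod_X_sub_C hQn fun z hz => (hPz z hz).2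
  have hroot : ∀ i, Q.IsRoot (α i) := fun i => by
    rw [IsRoot, hQα, eval_mul, eval_prod,
      Finset.prod_eq_zero (Finset.mem_univ i) (by simp), mul_zero]
  have h1 := sum_circleDeviation_le hQ0 hα hQα hβ0 rfl
  set L := Real.log (bergmanNorm Q) with hLdef
  have hT : L + 3 / 2 * (β * n + (L + 1) / β) ≤ η * n := by
    have a1 : L ≤ η / 6 * n := hL.le.trans (by gcongr; exact min_le_left _ _)
    have a2 : L ≤ η * β / 9 * n := hL.le.trans (by gcongr; exact min_le_right _ _)
    have a3 : 1 ≤ 2 * β * η / 9 * n := by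
      have := (le_max_left _ _).trans hn2
      rw [div_le_iff₀ (by positivity)] at this
      linarith
    have a4 : (L + 1) / β ≤ η * n / 3 := by
      rw [div_le_iff₀ hβ0]
      linarith
    have a5 : β * n = 2 / 9 * (η * n) := by
      rw [hβ]
      ring
    linarith
  have h2 := le_of_eval_le_exp hnd hn0 hQ0 hα hQα hq hd hκ hK
    (fun i => hqz _ (hPz _ (hroot i)).1) (h1.trans hT)
  rw [← hd_def] at h2
  have h3 : (1 + K + d) * (η * n) = κ * n / (4 * d) := by
    rw [hη]
    field_simp
  have h4 : κ + κ / (2 * d) ≤ κ / (16 * d) * n := by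
    have := (le_max_right _ _).trans hn2
    rw [div_le_iff₀ hκ] at this
    rw [div_mul_eq_mul_div, le_div_iff₀ (by positivity)]
    linarith
  have h5 : 0 < κ * n / d := by positivity
  have h6 : κ * (n - 1) / (2 * d) = κ * n / d / 2 - κ / (2 * d) := by
    field_simp
  have h7 : κ / (16 * d) * n = κ * n / d / 16 := by
    field_simp
  have h8 : κ * n / (4 * d) = κ * n / d / 4 := by
    field_simp
  rw [h3] at h2
  linarith

theorem corollary2p2 (E : Set ℂ) (hE : IsClosed E) (hT : ¬ Metric.sphere (0 : ℂ) 1 ⊆ E) :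
    ∃ C : ℝ, 1 < C ∧
      ∀ (N : Set ℕ), N.Infinite → ∀ (P : ℕ → ℤ[X]),
        (∀ n ∈ N, (P n).degree = (n : WithBot ℕ)) →
        (∀ n ∈ N, ∀ z : ℂ, ((P n).map (Int.castRingHom ℂ)).IsRoot z →
          z ∈ E ∧ ((P n).map (Int.castRingHom ℂ)).rootMultiplicity z = 1) →
        (C : EReal) ≤
          liminf (fun n : ℕ =>
            ((bergmanNorm ((P n).map (Int.castRingHom ℂ)) ^ (1 / (n : ℝ)) : ℝ) : EReal))
            (atTop ⊓ 𝓟 N) := by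
  obtain ⟨ζ, hζ, hζE⟩ := Set.not_subset.1 hT
  obtain ⟨r, hr, hrE⟩ := Metric.isOpen_iff.1 hE.isOpen_compl ζ hζE
  obtain ⟨ε, hε, hev⟩ := exists_eventually_mul_le_log_bergmanNorm (by simpa using hζ) hr
  refine ⟨Real.exp ε, Real.one_lt_exp_iff.2 hε, fun N _ P hdeg hroot => ?_⟩
  refine le_liminf_of_le (by isBoundedDefault) ?_
  rw [eventually_inf_principal]
  filter_upwards [hev, eventually_gt_atTop 0] with n hn hn0 hnN
  have hn' : (0 : ℝ) < n := by exact_mod_cast hn0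
  have h1 := hn (P n) (hdeg n hnN) fun z hz => by
    obtain ⟨hzE, hz1⟩ := hroot n hnN z hz
    refine ⟨?_, hz1⟩
    by_contra! h
    exact hrE (by rwa [Metric.mem_ball, dist_eq_norm]) hzE
  have hpos : 0 < bergmanNorm ((P n).map (Int.castRingHom ℂ)) := Real.exp_pos _
  rw [EReal.coe_le_coe_iff, Real.rpow_def_of_pos hpos, Real.exp_le_exp, mul_one_div,
    le_div_iff₀ hn']
  exact h1
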